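/- Let $d\ge 3$ be an odd integer, $X=\{1,\dots,d\}$, and let $T$ be the $d$-regular rooted tree with vertex set $X^*$ (finite words over $X$, the empty word being the root, the children of $u$ being the words $ux$, $x\in X$). For $g\in\mathrm{Aut}(T)$ and $u\in X^*$, the section $g|_u\in\mathrm{Aut}(T)$ is defined by $g(uv)=g(u)\,g|_u(v)$ for all $v\in X^*$. Let $G_d\le\mathrm{Aut}(T)$ be the group generated by $A=\{a_1,\dots,a_d\}$, where, with indices read cyclically modulo $d$, the automorphism $a_i$ acts on the first level as the transposition $(i\ \ i{+}1)$ and its first-level sections are $a_i|_i=a_i$, $a_i|_{i+1}=a_{i+1}$ and $a_i|_x=e$ for $x\ne i,i+1$. For $k\ge 1$ let $\mathrm{St}_{G_d}(\widehat k)$ be the subgroup of all $g\in G_d$ fixing every vertex of $X^k$, and let $\psi_k:\mathrm{St}_{G_d}(\widehat k)\to \mathrm{Aut}(T)^{X^k}$ be the homomorphism $\psi_k(g)=(g|_u)_{u\in X^k}$. For a vertex $u$ let $\mathrm{Rist}_{G_d}(u)$ be the subgroup of all $g\in G_d$ that fix every vertex not of the form $uv$, $v\in X^*$, and let $\mathrm{Rist}_{G_d}(\widehat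 k)\le\mathrm{St}_{G_d}(\widehat k)$ be the subgroup generated by all $\mathrm{Rist}_{G_d}(u)$ with $u\in X^k$. For a group word $w$ in $a_1,\dots,a_d$ let $|w|_A\in\mathbb Z$ be its total exponent sum. Then $|w|_A$ depends only on the element of $G_d$ represented by $w$, and, with $$H_k=\{w\in G_d : |w|_A\equiv 0 \pmod{2^{k+1}}\},$$ for every $k\ge 1$ $$\psi_k\bigl(\mathrm{Rist}_{G_d}(\widehat k)\bigr)=\underbrace{H_k\times\cdots\times H_k}_{d^k},$$ the product being indexed by the $d^k$ vertices of $X^k$. -/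

import Mathlib

namespace RootedTree

/-- `IsChild u v`: in the rooted tree with vertex set `X^*` (finite words over `X`, root the empty
word), the vertex `v` is a child of `u`, that is, `v = ux` for a letter `x`. -/
def IsChild {X : Type*} (u v : List X) : Prop := ∃ x : X, v = u ++ [x]

/-- `Aut(T)`: the bijections of the vertex set `X^*` which fix the root and preserve
the parent-child relation. Multiplication is composition, `(g * h) u = g (h u)`. -/
def Aut (X : Type*) : Subgroup (Equiv.Perm (List X)) where
  carrier := {g | g [] = [] ∧ ∀ u v : List X, IsChild (g u) (g v) ↔ IsChild u v}
  one_mem' := ⟨rfl, fun _ _ => Iff.rfl⟩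
  mul_mem' := by
    rintro g h ⟨g0, hg⟩ ⟨h0, hh⟩
    refine ⟨by simp [h0, g0], fun u v => ?_⟩
    rw [Equiv.Perm.mul_apply, Equiv.Perm.mul_apply, hg, hh]
  inv_mem' := by
    rintro g ⟨g0, hg⟩
    refine ⟨by rw [Equiv.Perm.inv_eq_iff_eq, g0], fun u v => ?_⟩
    have h : ∀ w, g (g⁻¹ w) = w := fun w => g.apply_symm_apply w
    rw [← hg, h, h]

/-- The image of the vertex `u` under the tree automorphism `g`. -/
def act {X : Type*} (g : Aut X) (u : List X) : List X := (g : Equiv.Perm (List X)) u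

section Basic

variable {X : Type*}

theorem act_one (u : List X) : act (1 : Aut X) u = u := rfl

theorem act_mul (g h : Aut X) (u : List X) : act (g * h) u = act g (act h u) := rfl

theorem act_inv_act (g : Aut X) (u : List X) : act g⁻¹ (act g u) = u := by
  rw [← act_mul, inv_mul_cancel, act_one]

theorem act_act_inv (g : Aut X) (u : List X) : act g (act g⁻¹ u) = u := by
  rw [← act_mul, mul_inv_cancel, act_one]

theorem act_nil (g : Aut X) : act g [] = [] := g.2.1

theorem isChild_act (g : Aut X) (u v : List X) : IsChild (act g u) (act g v) ↔ IsChild u v :=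
  g.2.2 u v

theorem act_ext {g h : Aut X} (H : ∀ u, act g u = act h u) : g = h :=
  Subtype.ext (Equiv.ext H)

theorem length_act (g : Aut X) (u : List X) : (act g u).length = u.length := by
  induction u using List.reverseRecOn with
  | nil => rw [act_nil]
  | append_singleton u x ih =>
    obtain ⟨y, hy⟩ := (isChild_act g u (u ++ [x])).2 ⟨x, rfl⟩
    rw [hy, List.length_append, List.length_append, ih]
    rfl

theorem prefix_act (g : Aut X) (u v : List X) : act g u <+: act g (u ++ v) := by
  induction v using List.reverseRecOn with
  | nil => rw [List.append_nil]
  | append_singleton v x ih =>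
    obtain ⟨y, hy⟩ := (isChild_act g (u ++ v) (u ++ v ++ [x])).2 ⟨x, rfl⟩
    rw [← List.append_assoc, hy]
    exact ih.trans (List.prefix_append _ _)

/-- The word `v'` with `g (uv) = g(u) v'`. -/
def sectFun (g : Aut X) (u v : List X) : List X := (act g (u ++ v)).drop u.length

theorem act_append (g : Aut X) (u v : List X) : act g (u ++ v) = act g u ++ sectFun g u v := by
  obtain ⟨t, ht⟩ := prefix_act g u v
  have : sectFun g u v = t := by
    rw [sectFun, ← ht, ← length_act g u, List.drop_left]
  rw [this, ht]

theorem sectFun_mul (g h : Aut X) (u v : List X) :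
    sectFun (g * h) u v = sectFun g (act h u) (sectFun h u v) := by
  have h1 := act_append (g * h) u v
  rw [act_mul, act_mul, act_append h, act_append g] at h1
  exact (List.append_cancel_left h1).symm

theorem sectFun_one (u v : List X) : sectFun (1 : Aut X) u v = v := by
  rw [sectFun, act_one, List.drop_left]

/-- The section `g|_u` of `g` at the vertex `u`: the tree automorphism determined by
`g (uv) = g(u) (g|_u)(v)`; see `act_append` and `act_sect`. -/
def sect (g : Aut X) (u : List X) : Aut X where
  val :=
    { toFun := sectFun g u
      invFun := sectFun g⁻¹ (act g u)
      left_inv := fun v => by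
        rw [← sectFun_mul, inv_mul_cancel, sectFun_one]
      right_inv := fun v => by
        have h := sectFun_mul g g⁻¹ (act g u) v
        rw [mul_inv_cancel, sectFun_one, act_inv_act] at h
        exact h.symm }
  property := by
    refine ⟨?_, fun v w => ?_⟩
    · change sectFun g u [] = []
      rw [sectFun, List.append_nil, ← length_act g u, List.drop_length]
    · change IsChild (sectFun g u v) (sectFun g u w) ↔ IsChild v w
      have h := isChild_act g (u ++ v) (u ++ w)
      rw [act_append, act_append] at h
      simpa [IsChild, List.append_assoc] using h

theorem act_sect (g : Aut X) (u v : List X) : act (sect g u) v = sectFun g u v := rfl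

theorem sect_mul (g h : Aut X) (u : List X) :
    sect (g * h) u = sect g (act h u) * sect h u :=
  act_ext fun v => sectFun_mul g h u v

theorem sect_one (u : List X) : sect (1 : Aut X) u = 1 :=
  act_ext fun v => sectFun_one u v

end Basic

/-- `X^k`, the vertices at level `k`. -/
abbrev Level (X : Type*) (k : ℕ) : Type _ := {u : List X // u.length = k}

/-- The level stabilizer `St_G(k)`: the elements of `G` which fix every vertex at level `k`. -/
def levelStab {X : Type*} (G : Subgroup (Aut X)) (k : ℕ) : Subgroup (Aut X) where
  carrier := {g | g ∈ G ∧ ∀ u : List X, u.length = k → act g u = u}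
  one_mem' := ⟨G.one_mem, fun u _ => act_one u⟩
  mul_mem' := by
    rintro g h ⟨gG, hg⟩ ⟨hG, hh⟩
    exact ⟨G.mul_mem gG hG, fun u hu => by rw [act_mul, hh u hu, hg u hu]⟩
  inv_mem' := by
    rintro g ⟨gG, hg⟩
    refine ⟨G.inv_mem gG, fun u hu => ?_⟩
    conv_lhs => rw [← hg u hu]
    exact act_inv_act g u

/-- The rigid stabilizer `Rist_G(u)` of the vertex `u`: the elements of `G` which fix
every vertex outside the subtree rooted at `u`. -/
def rist {X : Type*} (G : Subgroup (Aut X)) (u : List X) : Subgroup (Aut X) where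
  carrier := {g | g ∈ G ∧ ∀ v : List X, ¬ u <+: v → act g v = v}
  one_mem' := ⟨G.one_mem, fun u _ => act_one u⟩
  mul_mem' := by
    rintro g h ⟨gG, hg⟩ ⟨hG, hh⟩
    exact ⟨G.mul_mem gG hG, fun u hu => by rw [act_mul, hh u hu, hg u hu]⟩
  inv_mem' := by
    rintro g ⟨gG, hg⟩
    refine ⟨G.inv_mem gG, fun u hu => ?_⟩
    conv_lhs => rw [← hg u hu]
    exact act_inv_act g u

/-- The level rigid stabilizer `Rist_G(k)`: the subgroup generated by
the rigid stabilizers of all vertices at level `k`. -/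
def levelRist {X : Type*} (G : Subgroup (Aut X)) (k : ℕ) : Subgroup (Aut X) :=
  ⨆ u : Level X k, rist G u.1

/-- A rigid stabilizer of a vertex at level `k` fixes the whole level. -/
theorem levelRist_le_levelStab {X : Type*} (G : Subgroup (Aut X)) (k : ℕ) :
    levelRist G k ≤ levelStab G k := by
  refine iSup_le ?_
  rintro ⟨u, hu⟩ g ⟨gG, hg⟩
  refine ⟨gG, fun v hv => ?_⟩
  by_contra hne
  have huv : u = v := by
    by_contra h
    exact hne (hg v fun hp => h (hp.eq_of_length (hu.trans hv.symm)))
  subst huv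
  -- the vertex `g u` differs from `u`, so it is fixed, against injectivity
  have h1 : act g (act g u) = act g u := by
    refine hg _ fun hp => hne ?_
    exact (hp.eq_of_length (length_act g u).symm).symm
  have h2 := congrArg (act g⁻¹) h1
  rw [act_inv_act, act_inv_act] at h2
  exact hne h2

/-- The homomorphism `ψ_k` sending `g ∈ St_G(k)` to the family of its sections `g|_u` at
the vertices `u` of level `k`. -/
def psi {X : Type*} (G : Subgroup (Aut X)) (k : ℕ) : levelStab G k →* (Level X k → Aut X) where
  toFun g := fun u => sect g.1 u.1
  map_one' := funext fun u => sect_one u.1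
  map_mul' g h := funext fun u => by
    change sect (g.1 * h.1) u.1 = sect g.1 u.1 * sect h.1 u.1
    rw [sect_mul, h.2.2 u.1 u.2]

section Generators

variable {d : ℕ} [NeZero d]

/-- The generator `a_i` as a map on words: `i v ↦ (i+1) a_i(v)`, `(i+1) v ↦ i a_{i+1}(v)`, and
`x v ↦ x v` for the other letters. The letters and indices `1, …, d` are represented by
`0, …, d - 1` in `Fin d`, where addition is cyclic. -/
def genFun (i : Fin d) : List (Fin d) → List (Fin d)
  | [] => []
  | x :: v =>
    if x = i then (i + 1) :: genFun i v
    else if x = i + 1 then i :: genFun (i + 1) v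
    else x :: v

/-- The inverse map of `genFun i`. -/
def genInv (i : Fin d) : List (Fin d) → List (Fin d)
  | [] => []
  | x :: v =>
    if x = i + 1 then i :: genInv i v
    else if x = i then (i + 1) :: genInv (i + 1) v
    else x :: v

theorem genInv_genFun (i : Fin d) (v : List (Fin d)) : genInv i (genFun i v) = v := by
  induction v generalizing i with
  | nil => rfl
  | cons x v ih =>
    by_cases h1 : x = i
    · simp [genFun, genInv, h1, ih]
    · by_cases h2 : x = i + 1
      · have h3 : ¬ i = i + 1 := fun h => h1 (h2.trans h.symm)
        rw [genFun, if_neg h1, if_pos h2, genInv, if_neg h3, if_pos rfl, ih, h2]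
      · rw [genFun, if_neg h1, if_neg h2, genInv, if_neg h2, if_neg h1]

theorem genFun_genInv (i : Fin d) (v : List (Fin d)) : genFun i (genInv i v) = v := by
  induction v generalizing i with
  | nil => rfl
  | cons x v ih =>
    by_cases h1 : x = i + 1
    · simp [genFun, genInv, h1, ih]
    · by_cases h2 : x = i
      · have h3 : ¬ i + 1 = i := fun h => h1 (h2.trans h.symm)
        rw [genInv, if_neg h1, if_pos h2, genFun, if_neg h3, if_pos rfl, ih, h2]
      · rw [genInv, if_neg h1, if_neg h2, genFun, if_neg h2, if_neg h1]

theorem genFun_append_singleton (i : Fin d) (u : List (Fin d)) (x : Fin d) :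
    IsChild (genFun i u) (genFun i (u ++ [x])) := by
  induction u generalizing i with
  | nil =>
    simp only [List.nil_append, genFun, IsChild]
    split_ifs <;> exact ⟨_, rfl⟩
  | cons y u ih =>
    simp only [List.cons_append, genFun]
    split_ifs
    · obtain ⟨z, hz⟩ := ih i
      exact ⟨z, by rw [hz, List.cons_append]⟩
    · obtain ⟨z, hz⟩ := ih (i + 1)
      exact ⟨z, by rw [hz, List.cons_append]⟩
    · exact ⟨x, rfl⟩

theorem genInv_append_singleton (i : Fin d) (u : List (Fin d)) (x : Fin d) :
    IsChild (genInv i u) (genInv i (u ++ [x])) := by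
  induction u generalizing i with
  | nil =>
    simp only [List.nil_append, genInv, IsChild]
    split_ifs <;> exact ⟨_, rfl⟩
  | cons y u ih =>
    simp only [List.cons_append, genInv]
    split_ifs
    · obtain ⟨z, hz⟩ := ih i
      exact ⟨z, by rw [hz, List.cons_append]⟩
    · obtain ⟨z, hz⟩ := ih (i + 1)
      exact ⟨z, by rw [hz, List.cons_append]⟩
    · exact ⟨x, rfl⟩

/-- The generator `a_i = (e, …, e, a_i, a_{i+1}, e, …, e) (i i+1)` as a tree automorphism: it
swaps the letters `i` and `i+1` (cyclically), its section at `i` is `a_i`, its section at `i+1` is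
`a_{i+1}`, and its other first-level sections are trivial. -/
def gen (i : Fin d) : Aut (Fin d) where
  val := ⟨genFun i, genInv i, genInv_genFun i, genFun_genInv i⟩
  property := by
    refine ⟨rfl, fun u v => ⟨?_, ?_⟩⟩
    · rintro ⟨y, hy⟩
      change genFun i v = genFun i u ++ [y] at hy
      have h := genInv_append_singleton i (genFun i u) y
      rwa [← hy, genInv_genFun, genInv_genFun] at h
    · rintro ⟨x, rfl⟩
      exact genFun_append_singleton i u x

end Generators

/-- The group `G_d` generated by `a_1, …, a_d`. -/
def G (d : ℕ) [NeZero d] : Subgroup (Aut (Fin d)) :=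
  Subgroup.closure (Set.range (gen : Fin d → Aut (Fin d)))

/-- The element of `G_d` represented by a group word `w` in `a_1, …, a_d`. -/
def eval {d : ℕ} [NeZero d] : FreeGroup (Fin d) →* Aut (Fin d) := FreeGroup.lift gen

/-- The total exponent sum `|w|_A` of a group word `w`. -/
def expSum {d : ℕ} (w : FreeGroup (Fin d)) : ℤ :=
  Multiplicative.toAdd (FreeGroup.lift (fun _ : Fin d => Multiplicative.ofAdd (1 : ℤ)) w)

/-- `H_k`: the elements of `G_d` represented by a group word whose total exponent sum is
congruent to `0` modulo `2^(k+1)`. -/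
def H (d : ℕ) [NeZero d] (k : ℕ) : Subgroup (Aut (Fin d)) where
  carrier := {g | g ∈ G d ∧ ∃ w : FreeGroup (Fin d), eval w = g ∧ expSum w ≡ 0 [ZMOD 2 ^ (k + 1)]}
  one_mem' := ⟨(G d).one_mem, 1, map_one _, by simp [expSum]⟩
  mul_mem' := by
    rintro g h ⟨gG, v, rfl, hv⟩ ⟨hG, w, rfl, hw⟩
    refine ⟨(G d).mul_mem gG hG, v * w, map_mul _ _ _, ?_⟩
    have : expSum (v * w) = expSum v + expSum w := by simp [expSum]
    rw [this]
    simpa using hv.add hw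
  inv_mem' := by
    rintro g ⟨gG, v, rfl, hv⟩
    refine ⟨(G d).inv_mem gG, v⁻¹, map_inv _ _, ?_⟩
    have : expSum v⁻¹ = - expSum v := by simp [expSum]
    rw [this]
    simpa using hv.neg

end RootedTree

/-! Everything rests on one count: a letter `a_i^{±1}` has exactly two nontrivial first-level
sections, each a single letter with the same sign. So the sections of a word are no longer than the
word, and their exponent sums add up to twice its own.

Well-definedness (`expWord_eq_zero`). Take a shortest trivial word with nonzero exponent sum. If a
single section has nonzero sum, it is again shortest and its sum has doubled; this cannot go on,
since the sum is bounded by the length. So at some stage two sections keep full length, which forces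
all letters to have the same index. What remains is a power of `a_i`, whose section at `i`
alternates between `a_i` and `a_{i+1}` and admits neither alternative.

Sections of rigid elements lie in `H_k` (`sect_mem_H_of_mem_rist`). For `g` in the rigid stabilizer
of a vertex at level `k`, the exponent sum doubles at each step down, giving `2^k`. One more factor
2 comes from parity: `g` fixes the first level, and generators act there as transpositions.

Every element of `H_k` occurs (`exists_rist_of_mem_H`). The elements that `G_d` can place at one
first-level vertex, with trivial sections elsewhere, form a subgroup normalized by `G_d`. It
contains `a_i a_{i+2}⁻¹`, from the braid relation, hence for odd `d` all elements of exponent sum 0;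
one explicit word adds `a_0^4`. So it contains everything of exponent sum divisible by 4, and deeper
levels follow by lifting one letter at a time, halving the sum. -/

namespace RootedTree

/-! ### Calculus of sections -/

section Sections

variable {X : Type*}

theorem sect_inv (g : Aut X) (u : List X) : sect g⁻¹ u = (sect g (act g⁻¹ u))⁻¹ := by
  have h := sect_mul g g⁻¹ u
  rw [mul_inv_cancel, sect_one] at h
  exact (inv_eq_of_mul_eq_one_right h.symm).symm

theorem sect_inv_of_fixed {g : Aut X} {u : List X} (h : act g u = u) :
    sect g⁻¹ u = (sect g u)⁻¹ := by
  have h' : act g⁻¹ u = u := by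
    conv_lhs => rw [← h]
    exact act_inv_act g u
  rw [sect_inv, h']

theorem act_append_sect (g : Aut X) (u v : List X) :
    act g (u ++ v) = act g u ++ act (sect g u) v := act_append g u v

theorem sect_append (g : Aut X) (u v : List X) : sect g (u ++ v) = sect (sect g u) v := by
  refine act_ext fun w => ?_
  have h := act_append_sect g (u ++ v) w
  rw [List.append_assoc, act_append_sect, act_append_sect, act_append_sect g u v,
    List.append_assoc] at h
  exact (List.append_cancel_left (List.append_cancel_left h)).symm

theorem sect_nil (g : Aut X) : sect g [] = g :=
  act_ext fun v => by
    have h := act_append_sect g [] v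
    rw [act_nil] at h
    exact h.symm

theorem act_eq_of_act_append {g : Aut X} {u v : List X} (h : act g (u ++ v) = u ++ v) :
    act g u = u := by
  rw [act_append_sect] at h
  exact (List.append_inj h (length_act g u)).1

end Sections

/-! ### First-level data of the generators; cyclic index arithmetic -/

section Generators

variable {d : ℕ} [NeZero d]

theorem act_gen (i x : Fin d) : act (gen i) [x] = [Equiv.swap i (i + 1) x] := by
  change genFun i [x] = _
  rw [Equiv.swap_apply_def]
  simp only [genFun]
  split_ifs <;> rfl

theorem sect_gen_self (i : Fin d) : sect (gen i) [i] = gen i := by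
  refine act_ext fun v => ?_
  change (genFun i (i :: v)).drop 1 = genFun i v
  simp [genFun]

theorem sect_gen_succ (i : Fin d) : sect (gen i) [i + 1] = gen (i + 1) := by
  refine act_ext fun v => ?_
  change (genFun i ((i + 1) :: v)).drop 1 = genFun (i + 1) v
  by_cases h1 : i + 1 = i
  · rw [genFun, if_pos h1, h1]
    rfl
  · rw [genFun, if_neg h1, if_pos rfl]
    rfl

theorem sect_gen_of_ne {i x : Fin d} (h1 : x ≠ i) (h2 : x ≠ i + 1) : sect (gen i) [x] = 1 := by
  refine act_ext fun v => ?_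
  change (genFun i (x :: v)).drop 1 = v
  simp [genFun, h1, h2]

theorem one_ne_zero_fin (hd : 3 ≤ d) : (1 : Fin d) ≠ 0 := by
  intro h
  have := congrArg Fin.val h
  rw [Fin.val_one', Fin.val_zero, Nat.mod_eq_of_lt (by omega)] at this
  omega

theorem one_add_one_ne_zero_fin (hd : 3 ≤ d) : (1 + 1 : Fin d) ≠ 0 := by
  intro h
  have := congrArg Fin.val h
  rw [Fin.val_add, Fin.val_one', Fin.val_zero, Nat.mod_eq_of_lt (by omega : 1 < d),
    Nat.mod_eq_of_lt (by omega)] at this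
  omega

theorem succ_ne_self_fin (hd : 3 ≤ d) (i : Fin d) : i + 1 ≠ i := by
  simpa using one_ne_zero_fin hd

theorem add_two_ne_self_fin (hd : 3 ≤ d) (i : Fin d) : i + 1 + 1 ≠ i := by
  rw [add_assoc]
  simpa using one_add_one_ne_zero_fin hd

/-- For odd `d`, the steps by two connect all residues modulo `d`. -/
theorem forall_fin_of_add_two (hodd : Odd d) {P : Fin d → Prop} {i : Fin d} (h0 : P i)
    (h2 : ∀ j, P j → P (j + 1 + 1)) (j : Fin d) : P j := by
  have hn : ∀ n : ℕ, P (i + n • (1 + 1)) := by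
    intro n
    induction n with
    | zero => simpa using h0
    | succ n ih =>
      have := h2 _ ih
      rwa [add_assoc (i + _), add_assoc i, ← succ_nsmul] at this
  obtain ⟨m, hm⟩ := hodd
  have hd0 : d • (1 : Fin d) = 0 := by
    simpa using card_nsmul_eq_zero (G := Fin d) (x := 1)
  -- With `d = 2m + 1`, the number `m + 1` is the inverse of 2 modulo `d`.
  have h1 : (m + 1) • (1 + 1 : Fin d) = 1 := by
    have e : (m + 1) • (1 + 1 : Fin d) = (d + 1) • 1 := by
      have e2 : (m + 1) * 2 = d + 1 := by omega
      rw [← two_nsmul, ← mul_nsmul', e2]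
    rw [e, succ_nsmul, hd0, zero_add]
  have h := hn ((m + 1) * (j - i).val)
  have e : ((m + 1) * (j - i).val) • (1 + 1 : Fin d) = j - i := by
    rw [mul_nsmul, h1]
    open Fin.CommRing in
    rw [nsmul_one, Fin.cast_val_eq_self]
  rwa [e, add_sub_cancel] at h

end Generators

/-! ### Words, their sections and exponent sums -/

section Words

variable {d : ℕ}

/-- The exponent sum of a word in the letters `a_i` and `a_i⁻¹`. -/
def expWord (w : List (Fin d × Bool)) : ℤ := (w.map fun l => bif l.2 then 1 else -1).sum

theorem expWord_cons (l : Fin d × Bool) (w : List (Fin d × Bool)) :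
    expWord (l :: w) = (bif l.2 then 1 else -1) + expWord w := by
  simp [expWord]

theorem expWord_append (v w : List (Fin d × Bool)) :
    expWord (v ++ w) = expWord v + expWord w := by
  simp [expWord]

theorem expSum_mk (w : List (Fin d × Bool)) : expSum (FreeGroup.mk w) = expWord w := by
  induction w with
  | nil => rfl
  | cons l w ih =>
    rw [expWord_cons, ← ih]
    simp only [expSum, FreeGroup.lift_mk, List.map_cons, List.prod_cons, toAdd_mul]
    cases l.2 <;> simp

theorem natAbs_expWord_le (w : List (Fin d × Bool)) : (expWord w).natAbs ≤ w.length := by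
  induction w with
  | nil => exact le_rfl
  | cons l w ih =>
    rw [expWord_cons, List.length_cons]
    cases l.2 <;> simp only [cond_true, cond_false] <;> omega

theorem even_length_iff (w : List (Fin d × Bool)) : Even (w.length : ℤ) ↔ Even (expWord w) := by
  induction w with
  | nil => simp [expWord]
  | cons l w ih =>
    rw [expWord_cons, List.length_cons, Nat.cast_add, Int.even_add, ih, Int.even_add]
    cases l.2 <;> simp

variable [NeZero d]

/-- The element represented by a word in the letters `a_i` and `a_i⁻¹`. -/
def evalWord (w : List (Fin d × Bool)) : Aut (Fin d) :=
  (w.map fun l => bif l.2 then gen l.1 else (gen l.1)⁻¹).prod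

/-- The section at a first-level vertex of a letter, as a word. -/
def letterSect (l : Fin d × Bool) (x : Fin d) : List (Fin d × Bool) :=
  if x = l.1 then [(bif l.2 then l.1 else l.1 + 1, l.2)]
  else if x = l.1 + 1 then [(bif l.2 then l.1 + 1 else l.1, l.2)] else []

/-- The action of a word on the first level. -/
def wordPerm (w : List (Fin d × Bool)) : Equiv.Perm (Fin d) :=
  (w.map fun l => Equiv.swap l.1 (l.1 + 1)).prod

/-- The section at a first-level vertex of a word, as a word. -/
def wordSect : List (Fin d × Bool) → Fin d → List (Fin d × Bool)
  | [], _ => []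
  | l :: w, x => letterSect l (wordPerm w x) ++ wordSect w x

theorem evalWord_cons (l : Fin d × Bool) (w : List (Fin d × Bool)) :
    evalWord (l :: w) = (bif l.2 then gen l.1 else (gen l.1)⁻¹) * evalWord w := by
  simp [evalWord]

theorem evalWord_append (v w : List (Fin d × Bool)) :
    evalWord (v ++ w) = evalWord v * evalWord w := by
  simp [evalWord]

theorem wordPerm_cons (l : Fin d × Bool) (w : List (Fin d × Bool)) (x : Fin d) :
    wordPerm (l :: w) x = Equiv.swap l.1 (l.1 + 1) (wordPerm w x) := by
  simp [wordPerm]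

theorem eval_mk (w : List (Fin d × Bool)) : eval (FreeGroup.mk w) = evalWord w :=
  FreeGroup.lift_mk

theorem act_gen_inv (i x : Fin d) : act (gen i)⁻¹ [x] = [Equiv.swap i (i + 1) x] := by
  have h := act_gen i (Equiv.swap i (i + 1) x)
  rw [Equiv.swap_apply_self] at h
  rw [← h, act_inv_act]

theorem act_letter (l : Fin d × Bool) (x : Fin d) :
    act (bif l.2 then gen l.1 else (gen l.1)⁻¹) [x] = [Equiv.swap l.1 (l.1 + 1) x] := by
  cases l.2
  · exact act_gen_inv _ _
  · exact act_gen _ _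

/-- Inversion exchanges the two indices: `a_i⁻¹|_i = (a_i|_{i+1})⁻¹ = a_{i+1}⁻¹`, and likewise
`a_i⁻¹|_{i+1} = a_i⁻¹`. -/
theorem sect_letter (l : Fin d × Bool) (x : Fin d) :
    sect (bif l.2 then gen l.1 else (gen l.1)⁻¹) [x] = evalWord (letterSect l x) := by
  obtain ⟨i, b⟩ := l
  by_cases h1 : x = i
  · subst h1
    cases b <;> simp [letterSect, evalWord, sect_inv, act_gen_inv, sect_gen_self, sect_gen_succ]
  by_cases h2 : x = i + 1
  · subst h2
    cases b <;>
      simp [letterSect, h1, evalWord, sect_inv, act_gen_inv, sect_gen_self, sect_gen_succ]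
  · cases b <;>
      simp [letterSect, h1, h2, evalWord, sect_inv, act_gen_inv, Equiv.swap_apply_of_ne_of_ne,
        sect_gen_of_ne]

theorem act_evalWord (w : List (Fin d × Bool)) (x : Fin d) :
    act (evalWord w) [x] = [wordPerm w x] := by
  induction w with
  | nil => rfl
  | cons l w ih => rw [evalWord_cons, act_mul, ih, act_letter, wordPerm_cons]

theorem sect_evalWord (w : List (Fin d × Bool)) (x : Fin d) :
    sect (evalWord w) [x] = evalWord (wordSect w x) := by
  induction w with
  | nil => exact sect_one _
  | cons l w ih =>
    rw [evalWord_cons, sect_mul, ih, act_evalWord, sect_letter, wordSect, evalWord_append]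

theorem length_letterSect_le (l : Fin d × Bool) (x : Fin d) : (letterSect l x).length ≤ 1 := by
  rw [letterSect]
  split_ifs <;> simp

theorem letterSect_eq_nil {l : Fin d × Bool} {x : Fin d} (h1 : x ≠ l.1) (h2 : x ≠ l.1 + 1) :
    letterSect l x = [] := by
  rw [letterSect, if_neg h1, if_neg h2]

theorem length_wordSect_le (w : List (Fin d × Bool)) (x : Fin d) :
    (wordSect w x).length ≤ w.length := by
  induction w with
  | nil => exact le_rfl
  | cons l w ih =>
    have := length_letterSect_le l (wordPerm w x)
    rw [wordSect, List.length_append, List.length_cons]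
    omega

/-- Only the vertices `i` and `i + 1` contribute, and they are distinct because `d ≥ 3`. -/
theorem sum_letterSect {M : Type*} [AddCommMonoid M] (hd : 3 ≤ d) (l : Fin d × Bool)
    (f : List (Fin d × Bool) → M) (hf : f [] = 0) (c : M) (hc : ∀ i, f [(i, l.2)] = c) :
    ∑ x, f (letterSect l x) = c + c := by
  have hne := succ_ne_self_fin hd l.1
  rw [← Finset.sum_subset (Finset.subset_univ {l.1, l.1 + 1}), Finset.sum_pair hne.symm]
  · simp [letterSect, hne, hc]
  · intro x _ hx
    simp only [Finset.mem_insert, Finset.mem_singleton, not_or] at hx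
    rw [letterSect_eq_nil hx.1 hx.2, hf]

theorem sum_expWord_wordSect (hd : 3 ≤ d) (w : List (Fin d × Bool)) :
    ∑ x, expWord (wordSect w x) = 2 * expWord w := by
  induction w with
  | nil => simp [wordSect, expWord]
  | cons l w ih =>
    simp only [wordSect, expWord_append, expWord_cons]
    rw [Finset.sum_add_distrib, ih,
      Equiv.sum_comp (wordPerm w) fun x => expWord (letterSect l x),
      sum_letterSect hd l expWord rfl (bif l.2 then 1 else -1) fun _ => by simp [expWord]]
    ring

theorem sign_wordPerm (hd : 3 ≤ d) (w : List (Fin d × Bool)) :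
    Equiv.Perm.sign (wordPerm w) = (-1) ^ w.length := by
  induction w with
  | nil => simp [wordPerm]
  | cons l w ih =>
    have e : wordPerm (l :: w) = Equiv.swap l.1 (l.1 + 1) * wordPerm w := by simp [wordPerm]
    rw [e, map_mul, ih, Equiv.Perm.sign_swap (succ_ne_self_fin hd l.1).symm, List.length_cons,
      pow_succ']

/-- A word fixing the first level has even exponent sum. -/
theorem even_expWord (hd : 3 ≤ d) {w : List (Fin d × Bool)}
    (h : ∀ x, act (evalWord w) [x] = [x]) : Even (expWord w) := by
  have hp : wordPerm w = 1 := by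
    ext x
    have := h x
    rw [act_evalWord] at this
    simpa using congrArg Fin.val (List.singleton_injective this)
  -- Each letter acts as a transposition, so a trivial action forces even length, and length and
  -- exponent sum have the same parity.
  have hs := sign_wordPerm hd w
  rw [hp, map_one] at hs
  rw [← even_length_iff, Int.even_coe_nat]
  by_contra ho
  rw [Nat.not_even_iff_odd] at ho
  rw [ho.neg_one_pow] at hs
  exact absurd hs (by decide)

end Words

/-! ### The exponent sum is well defined on the group -/

section WellDefined

variable {d : ℕ}

theorem expWord_replicate (i : Fin d) (n : ℕ) : expWord (List.replicate n (i, true)) = n := by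
  simp [expWord]

theorem expSum_mul (v w : FreeGroup (Fin d)) : expSum (v * w) = expSum v + expSum w := by
  simp [expSum]

theorem expSum_inv (v : FreeGroup (Fin d)) : expSum v⁻¹ = -expSum v := by
  simp [expSum]

variable [NeZero d]

/-- If the sections of `w` at two vertices are as long as `w`, every letter of `w` swaps the two
tracks. -/
theorem mem_swap_of_length_wordSect {x y : Fin d} (hxy : x ≠ y) (w : List (Fin d × Bool))
    (hx : (wordSect w x).length = w.length) (hy : (wordSect w y).length = w.length) :
    (wordPerm w x = x ∧ wordPerm w y = y ∨ wordPerm w x = y ∧ wordPerm w y = x) ∧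
      ∀ l ∈ w, x = l.1 ∧ y = l.1 + 1 ∨ y = l.1 ∧ x = l.1 + 1 := by
  induction w with
  | nil => simp [wordPerm]
  | cons l w ih =>
    have key : ∀ z, (wordSect (l :: w) z).length = (l :: w).length →
        (wordSect w z).length = w.length ∧ (wordPerm w z = l.1 ∨ wordPerm w z = l.1 + 1) := by
      intro z hz
      rw [wordSect, List.length_append, List.length_cons] at hz
      have h1 := length_letterSect_le l (wordPerm w z)
      have h2 := length_wordSect_le w z
      refine ⟨by omega, ?_⟩
      by_contra hc
      rw [not_or] at hc
      rw [letterSect_eq_nil hc.1 hc.2, List.length_nil] at hz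
      omega
    obtain ⟨hx1, hx2⟩ := key x hx
    obtain ⟨hy1, hy2⟩ := key y hy
    obtain ⟨hp, hl⟩ := ih hx1 hy1
    -- No letter is lost on either track, so both current positions lie in `{i, i + 1}`; being
    -- distinct, they exhaust it.
    have hxl : x = l.1 ∧ y = l.1 + 1 ∨ y = l.1 ∧ x = l.1 + 1 := by
      rcases hp with ⟨h1, h2⟩ | ⟨h1, h2⟩ <;> rw [h1] at hx2 <;> rw [h2] at hy2 <;>
        rcases hx2 with hx2 | hx2 <;> rcases hy2 with hy2 | hy2 <;> grind
    refine ⟨?_, ?_⟩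
    · rw [wordPerm_cons, wordPerm_cons]
      rcases hxl with ⟨h3, h4⟩ | ⟨h3, h4⟩ <;> rw [← h4, ← h3] <;>
        rcases hp with ⟨h1, h2⟩ | ⟨h1, h2⟩ <;> rw [h1, h2] <;> simp
    · intro m hm
      rcases List.mem_cons.1 hm with rfl | hm
      · exact hxl
      · exact hl m hm

/-- For `d ≥ 3` the unordered pair `{i, i + 1}` determines `i`. -/
theorem exists_forall_fst_eq (hd : 3 ≤ d) {x y : Fin d} (hxy : x ≠ y) {w : List (Fin d × Bool)}
    (hx : (wordSect w x).length = w.length) (hy : (wordSect w y).length = w.length) :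
    ∃ i, ∀ l ∈ w, l.1 = i := by
  have h := (mem_swap_of_length_wordSect hxy w hx hy).2
  have h2 := add_two_ne_self_fin hd
  by_cases hyx : y = x + 1
  · refine ⟨x, fun l hl => ?_⟩
    rcases h l hl with ⟨h3, -⟩ | ⟨h3, h4⟩
    · exact h3.symm
    · exact absurd (by rw [← hyx, h3, ← h4]) (h2 x)
  · refine ⟨y, fun l hl => ?_⟩
    rcases h l hl with ⟨h3, h4⟩ | ⟨h3, -⟩
    · exact absurd (by rw [h3, h4]) hyx
    · exact h3.symm

/-- A trivial word of nonzero exponent sum. -/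
def IsBadWord (w : List (Fin d × Bool)) : Prop := evalWord w = 1 ∧ expWord w ≠ 0

theorem evalWord_wordSect_of_eq_one {w : List (Fin d × Bool)} (h : evalWord w = 1) (x : Fin d) :
    evalWord (wordSect w x) = 1 := by
  rw [← sect_evalWord, h, sect_one]

/-- Sections of a trivial word are trivial, so by minimality a section with nonzero exponent sum has
full length. Some section is of this kind, because the sums add up to `2 * expWord w ≠ 0`. If it is
the only one, it carries the whole sum; if there are two, the letters all share one index. -/
theorem IsBadWord.dichotomy (hd : 3 ≤ d) {n : ℕ}
    (hmin : ∀ v : List (Fin d × Bool), IsBadWord v → n ≤ v.length)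
    {w : List (Fin d × Bool)} (hw : IsBadWord w) (hn : w.length = n) :
    (∃ x, IsBadWord (wordSect w x) ∧ (wordSect w x).length = n ∧
      expWord (wordSect w x) = 2 * expWord w) ∨ ∃ i, ∀ l ∈ w, l.1 = i := by
  have hbad : ∀ x, expWord (wordSect w x) ≠ 0 → (wordSect w x).length = n := fun x hx =>
    le_antisymm (hn ▸ length_wordSect_le w x)
      (hmin _ ⟨evalWord_wordSect_of_eq_one hw.1 x, hx⟩)
  by_cases htwo : ∃ x y, x ≠ y ∧ expWord (wordSect w x) ≠ 0 ∧ expWord (wordSect w y) ≠ 0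
  · obtain ⟨x, y, hxy, hx, hy⟩ := htwo
    exact Or.inr (exists_forall_fst_eq hd hxy ((hbad x hx).trans hn.symm)
      ((hbad y hy).trans hn.symm))
  · have hsum := sum_expWord_wordSect hd w
    obtain ⟨x, hx⟩ : ∃ x, expWord (wordSect w x) ≠ 0 := by
      by_contra! hc
      rw [Finset.sum_eq_zero fun x _ => hc x] at hsum
      exact hw.2 (by omega)
    refine Or.inl ⟨x, ⟨evalWord_wordSect_of_eq_one hw.1 x, hx⟩, hbad x hx, ?_⟩
    rw [← hsum, Finset.sum_eq_single x]
    · intro y _ hyx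
      by_contra hy
      exact htwo ⟨y, x, hyx, hy, hx⟩
    · simp

theorem exists_isBadWord_forall_fst_eq (hd : 3 ≤ d) {n : ℕ}
    (hmin : ∀ v : List (Fin d × Bool), IsBadWord v → n ≤ v.length)
    {w : List (Fin d × Bool)} (hw : IsBadWord w) (hn : w.length = n) :
    ∃ v : List (Fin d × Bool), IsBadWord v ∧ v.length = n ∧ ∃ i, ∀ l ∈ v, l.1 = i := by
  -- The exponent sum doubles in the first alternative, yet never exceeds the length `n` in absolute
  -- value.
  induction hk : n - (expWord w).natAbs using Nat.strong_induction_on generalizing w with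
  | _ k ih =>
    rcases hw.dichotomy hd hmin hn with ⟨x, h1, h2, h3⟩ | h
    · refine ih _ ?_ h1 h2 rfl
      have h4 := natAbs_expWord_le (wordSect w x)
      have h5 := hw.2
      omega
    · exact ⟨w, hw, hn, h⟩

theorem evalWord_of_forall_fst_eq {i : Fin d} {w : List (Fin d × Bool)}
    (h : ∀ l ∈ w, l.1 = i) : evalWord w = gen i ^ expWord w := by
  induction w with
  | nil => rfl
  | cons l w ih =>
    rw [evalWord_cons, ih fun m hm => h m (List.mem_cons_of_mem _ hm), expWord_cons, zpow_add,
      h l List.mem_cons_self]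
    cases l.2 <;> simp

theorem evalWord_replicate (i : Fin d) (n : ℕ) :
    evalWord (List.replicate n (i, true)) = gen i ^ n := by
  simp [evalWord]

theorem wordSect_replicate (i : Fin d) (n : ℕ) :
    (wordPerm (List.replicate n (i, true)) i = i ∨
        wordPerm (List.replicate n (i, true)) i = i + 1) ∧
      (wordSect (List.replicate n (i, true)) i).length = n ∧
      expWord (wordSect (List.replicate n (i, true)) i) = n := by
  induction n with
  | zero => simp [wordPerm, wordSect, expWord]
  | succ n ih =>
    obtain ⟨h1, h2, h3⟩ := ih
    rw [List.replicate_succ, wordPerm_cons, wordSect, expWord_append, List.length_append, h2, h3]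
    rcases h1 with h | h
    · rw [h]
      simp [letterSect, expWord, add_comm]
    · rw [h]
      -- Without `d ≥ 3` the two indices may coincide, namely for `d = 1`.
      by_cases hi : i + 1 = i <;> simp [letterSect, expWord, add_comm, hi]

/-- The track of `i` alternates between `i` and `i + 1`, so the two leading letters of the section
are `a_i` and `a_{i+1}` in some order. -/
theorem not_forall_fst_wordSect_replicate (hd : 3 ≤ d) (i : Fin d) {n : ℕ} (hn : 2 ≤ n) (j : Fin d)
    (h : ∀ l ∈ wordSect (List.replicate n (i, true)) i, l.1 = j) : False := by
  obtain ⟨m, rfl⟩ := Nat.exists_eq_add_of_le' hn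
  have hne := succ_ne_self_fin hd i
  rw [List.replicate_succ, List.replicate_succ, wordSect, wordSect, wordPerm_cons] at h
  rcases (wordSect_replicate i m).1 with hp | hp <;> rw [hp] at h
  all_goals
    have h1 := h (i, true) (by simp [letterSect, hne])
    have h2 := h (i + 1, true) (by simp [letterSect, hne])
    exact hne (h2.trans h1.symm)

/-- The total exponent sum of a trivial word vanishes. -/
theorem expWord_eq_zero (hd : 3 ≤ d) {w : List (Fin d × Bool)} (hw : evalWord w = 1) :
    expWord w = 0 := by
  classical
  by_contra hne
  have hex : ∃ n, ∃ v : List (Fin d × Bool), IsBadWord v ∧ v.length = n := ⟨_, w, ⟨hw, hne⟩, rfl⟩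
  obtain ⟨u, hu, hun⟩ := Nat.find_spec hex
  have hmin : ∀ v : List (Fin d × Bool), IsBadWord v → Nat.find hex ≤ v.length := fun v hv =>
    Nat.find_le ⟨v, hv, rfl⟩
  generalize Nat.find hex = n at hun hmin
  obtain ⟨v, hv, hvn, i, hi⟩ := exists_isBadWord_forall_fst_eq hd hmin hu hun
  have hpow : gen i ^ (expWord v).natAbs = 1 := by
    have h := hv.1
    rw [evalWord_of_forall_fst_eq hi] at h
    rcases Int.natAbs_eq (expWord v) with he | he <;> rw [he] at h
    · simpa using h
    · simpa using h
  have hle := natAbs_expWord_le v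
  -- Passing to a positive power gives a bad word of length `|expWord v| ≤ n`; minimality then
  -- forces equality.
  have hrep : IsBadWord (List.replicate (expWord v).natAbs (i, true)) := by
    refine ⟨by rw [evalWord_replicate, hpow], ?_⟩
    rw [expWord_replicate]
    have := hv.2
    omega
  have hge := hmin _ hrep
  rw [List.length_replicate] at hge
  have hen : (expWord v).natAbs = n := by omega
  rw [hen] at hrep hpow
  have hn2 : 2 ≤ n := by
    by_contra hlt
    have h0 : n ≠ 0 := by
      have := hv.2
      omega
    have h1 : n = 1 := by omega
    rw [h1, pow_one] at hpow
    have h2 := act_gen i i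
    rw [hpow, act_one, Equiv.swap_apply_left] at h2
    exact succ_ne_self_fin hd i (List.singleton_injective h2).symm
  obtain ⟨-, hlen, hexp⟩ := wordSect_replicate i n
  have hbad : IsBadWord (wordSect (List.replicate n (i, true)) i) :=
    ⟨evalWord_wordSect_of_eq_one hrep.1 i, by rw [hexp]; omega⟩
  -- A doubled exponent sum `2n` would exceed the length bound `n`.
  rcases hbad.dichotomy hd hmin hlen with ⟨x, -, h2, h3⟩ | ⟨j, hj⟩
  · have := natAbs_expWord_le (wordSect (wordSect (List.replicate n (i, true)) i) x)
    omega
  · exact not_forall_fst_wordSect_replicate hd i hn2 j hj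

theorem expSum_eq_of_eval_eq (hd : 3 ≤ d) {v w : FreeGroup (Fin d)} (h : eval v = eval w) :
    expSum v = expSum w := by
  have h1 : eval (v * w⁻¹) = 1 := by rw [map_mul, map_inv, h, mul_inv_cancel]
  have h2 : expSum (v * w⁻¹) = 0 := by
    rw [← FreeGroup.mk_toWord (x := v * w⁻¹)] at h1 ⊢
    rw [eval_mk] at h1
    rw [expSum_mk, expWord_eq_zero hd h1]
  rw [expSum_mul, expSum_inv] at h2
  omega

end WellDefined

/-! ### Exponent sums of group elements -/

section Exponent

variable {d : ℕ} [NeZero d]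

/-- `g` is represented by a group word of total exponent sum `n`. -/
def HasExp (g : Aut (Fin d)) (n : ℤ) : Prop := ∃ w : FreeGroup (Fin d), eval w = g ∧ expSum w = n

theorem HasExp.unique (hd : 3 ≤ d) {g : Aut (Fin d)} {m n : ℤ} (hm : HasExp g m)
    (hn : HasExp g n) : m = n := by
  obtain ⟨v, hv, rfl⟩ := hm
  obtain ⟨w, hw, rfl⟩ := hn
  exact expSum_eq_of_eval_eq hd (hv.trans hw.symm)

theorem hasExp_one : HasExp (1 : Aut (Fin d)) 0 := ⟨1, map_one _, by simp [expSum]⟩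

theorem hasExp_gen (i : Fin d) : HasExp (gen i) 1 :=
  ⟨FreeGroup.of i, by simp [eval], by simp [expSum]⟩

theorem HasExp.mul {g h : Aut (Fin d)} {m n : ℤ} (hg : HasExp g m) (hh : HasExp h n) :
    HasExp (g * h) (m + n) := by
  obtain ⟨v, rfl, rfl⟩ := hg
  obtain ⟨w, rfl, rfl⟩ := hh
  exact ⟨v * w, map_mul _ _ _, expSum_mul v w⟩

theorem HasExp.inv {g : Aut (Fin d)} {n : ℤ} (hg : HasExp g n) : HasExp g⁻¹ (-n) := by
  obtain ⟨v, rfl, rfl⟩ := hg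
  exact ⟨v⁻¹, map_inv _ _, expSum_inv v⟩

theorem hasExp_evalWord (w : List (Fin d × Bool)) : HasExp (evalWord w) (expWord w) :=
  ⟨FreeGroup.mk w, eval_mk w, expSum_mk w⟩

theorem HasExp.exists_word {g : Aut (Fin d)} {n : ℤ} (hg : HasExp g n) :
    ∃ w, evalWord w = g ∧ expWord w = n := by
  obtain ⟨w, rfl, rfl⟩ := hg
  rw [← FreeGroup.mk_toWord (x := w)]
  exact ⟨_, (eval_mk _).symm, (expSum_mk _).symm⟩

theorem gen_mem (i : Fin d) : gen i ∈ G d := Subgroup.subset_closure ⟨i, rfl⟩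

theorem HasExp.mem {g : Aut (Fin d)} {n : ℤ} (hg : HasExp g n) : g ∈ G d := by
  obtain ⟨w, rfl, rfl⟩ := hg
  induction w using FreeGroup.induction_on with
  | C1 => rw [map_one]; exact one_mem _
  | of i => simpa [eval] using gen_mem i
  | inv_of i h => rw [map_inv]; exact inv_mem h
  | mul v w hv hw => rw [map_mul]; exact mul_mem hv hw

theorem exists_hasExp {g : Aut (Fin d)} (hg : g ∈ G d) : ∃ n, HasExp g n := by
  induction hg using Subgroup.closure_induction with
  | mem g hg =>
    obtain ⟨i, rfl⟩ := hg
    exact ⟨1, hasExp_gen i⟩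
  | one => exact ⟨0, hasExp_one⟩
  | mul g h _ _ ihg ihh =>
    obtain ⟨m, hm⟩ := ihg
    obtain ⟨n, hn⟩ := ihh
    exact ⟨_, hm.mul hn⟩
  | inv g _ ih =>
    obtain ⟨n, hn⟩ := ih
    exact ⟨_, hn.inv⟩

theorem mem_H_iff {k : ℕ} {g : Aut (Fin d)} :
    g ∈ H d k ↔ ∃ n, HasExp g n ∧ (2 : ℤ) ^ (k + 1) ∣ n := by
  constructor
  · rintro ⟨-, w, hw, h⟩
    exact ⟨_, ⟨w, hw, rfl⟩, Int.modEq_zero_iff_dvd.1 h⟩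
  · rintro ⟨n, hg, h⟩
    refine ⟨hg.mem, ?_⟩
    obtain ⟨w, hw, rfl⟩ := hg
    exact ⟨w, hw, Int.modEq_zero_iff_dvd.2 h⟩

/-- The exponent sums of the first-level sections add up to twice the exponent sum. -/
theorem HasExp.sections (hd : 3 ≤ d) {g : Aut (Fin d)} {n : ℤ} (hg : HasExp g n) :
    ∃ e : Fin d → ℤ, (∀ x, HasExp (sect g [x]) (e x)) ∧ ∑ x, e x = 2 * n := by
  obtain ⟨w, rfl, rfl⟩ := hg.exists_word
  refine ⟨fun x => expWord (wordSect w x), fun x => ?_, sum_expWord_wordSect hd w⟩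
  rw [sect_evalWord]
  exact hasExp_evalWord _

theorem HasExp.even (hd : 3 ≤ d) {g : Aut (Fin d)} {n : ℤ} (hg : HasExp g n)
    (h : ∀ x, act g [x] = [x]) : Even n := by
  obtain ⟨w, rfl, rfl⟩ := hg.exists_word
  exact even_expWord hd h

/-- If only one first-level section is nontrivial, its exponent sum is twice that of `g`. -/
theorem HasExp.sect_of_isolated (hd : 3 ≤ d) {g : Aut (Fin d)} {n : ℤ} (hg : HasExp g n)
    {x : Fin d} (h : ∀ y, y ≠ x → sect g [y] = 1) : HasExp (sect g [x]) (2 * n) := by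
  obtain ⟨e, he, hsum⟩ := hg.sections hd
  rw [Finset.sum_eq_single x] at hsum
  · rw [← hsum]
    exact he x
  · intro y _ hy
    have := he y
    rw [h y hy] at this
    exact this.unique hd hasExp_one
  · simp

end Exponent

/-! ### Self-replication -/

section Arrows

variable {d : ℕ} [NeZero d]

/-- Some element of `G_d` maps the first-level vertex `x` to `y` with section `h` at `x`. -/
def Arrow (x y : Fin d) (h : Aut (Fin d)) : Prop := ∃ g ∈ G d, act g [x] = [y] ∧ sect g [x] = h

theorem Arrow.comp {x y z : Fin d} {h k : Aut (Fin d)} (hxy : Arrow x y h) (hyz : Arrow y z k) :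
    Arrow x z (k * h) := by
  obtain ⟨g, hg, hga, rfl⟩ := hxy
  obtain ⟨f, hf, hfa, rfl⟩ := hyz
  exact ⟨f * g, mul_mem hf hg, by rw [act_mul, hga, hfa], by rw [sect_mul, hga]⟩

theorem Arrow.inv {x y : Fin d} {h : Aut (Fin d)} (hxy : Arrow x y h) : Arrow y x h⁻¹ := by
  obtain ⟨g, hg, hga, rfl⟩ := hxy
  have h1 : act g⁻¹ [y] = [x] := by rw [← hga, act_inv_act]
  exact ⟨g⁻¹, inv_mem hg, h1, by rw [sect_inv, h1]⟩

theorem arrow_gen (i : Fin d) : Arrow i (i + 1) (gen i) :=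
  ⟨gen i, gen_mem i, by rw [act_gen, Equiv.swap_apply_left], sect_gen_self i⟩

theorem arrow_gen_succ (i : Fin d) : Arrow (i + 1) i (gen (i + 1)) :=
  ⟨gen i, gen_mem i, by rw [act_gen, Equiv.swap_apply_right], sect_gen_succ i⟩

theorem arrow_refl (x : Fin d) : Arrow x x 1 := ⟨1, one_mem _, act_one _, sect_one _⟩

/-- The element `a_{j+1} a_j⁻¹` moves `j` to `j + 2` with section `a_{j+1} a_{j+1}⁻¹ = 1`, and for
odd `d` steps by two reach every vertex. -/
theorem arrow_one (hodd : Odd d) (x y : Fin d) : Arrow x y 1 := by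
  refine forall_fin_of_add_two hodd (P := fun y => Arrow x y 1) (arrow_refl x) (fun j hj => ?_) y
  have h := (arrow_gen_succ j).inv.comp (arrow_gen (j + 1))
  rw [mul_inv_cancel] at h
  simpa using hj.comp h

/-- `G_d` is self-replicating and transitive on the first level, in a strong form. -/
theorem arrow_of_mem (hodd : Odd d) {h : Aut (Fin d)} (hh : h ∈ G d) (x y : Fin d) :
    Arrow x y h := by
  induction hh using Subgroup.closure_induction generalizing x y with
  | mem g hg =>
    obtain ⟨i, rfl⟩ := hg
    simpa using ((arrow_one hodd x i).comp (arrow_gen i)).comp (arrow_one hodd (i + 1) y)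
  | one => exact arrow_one hodd x y
  | mul g h _ _ ihg ihh => exact (ihh x x).comp (ihg x y)
  | inv g _ ih => exact (ih y x).inv

end Arrows

/-! ### Elements that can be placed at a single first-level vertex -/

section Isolated

variable {d : ℕ} [NeZero d]

/-- The elements `h` such that `G_d` contains the element fixing the first level whose section
at `x` is `h` and whose other first-level sections are trivial. -/
def isolated (x : Fin d) : Subgroup (Aut (Fin d)) where
  carrier := {h | ∃ g ∈ G d, (∀ y, act g [y] = [y]) ∧ sect g [x] = h ∧
    ∀ y, y ≠ x → sect g [y] = 1}
  one_mem' := ⟨1, one_mem _, fun _ => act_one _, sect_one _, fun _ _ => sect_one _⟩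
  mul_mem' := by
    rintro _ _ ⟨f, hf, hfa, rfl, hfs⟩ ⟨g, hg, hga, rfl, hgs⟩
    refine ⟨f * g, mul_mem hf hg, fun y => by rw [act_mul, hga, hfa], by rw [sect_mul, hga],
      fun y hy => by rw [sect_mul, hga, hfs y hy, hgs y hy, one_mul]⟩
  inv_mem' := by
    rintro _ ⟨g, hg, hga, rfl, hgs⟩
    refine ⟨g⁻¹, inv_mem hg, fun y => ?_, sect_inv_of_fixed (hga x), fun y hy => ?_⟩
    · conv_lhs => rw [← hga y]
      exact act_inv_act _ _
    · rw [sect_inv_of_fixed (hga y), hgs y hy, inv_one]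

/-- Conjugate by an element of `G_d` that carries `x` to `y` with section `c`. The case `c = 1`
shows independence of the vertex, the case `x = y` normality. -/
theorem conj_mem_isolated (hodd : Odd d) {x y : Fin d} {c h : Aut (Fin d)} (hc : c ∈ G d)
    (hh : h ∈ isolated x) : c * h * c⁻¹ ∈ isolated y := by
  obtain ⟨g, hg, hga, rfl, hgs⟩ := hh
  obtain ⟨f, hf, hfa, rfl⟩ := arrow_of_mem hodd hc x y
  have hfi : act f⁻¹ [y] = [x] := by rw [← hfa, act_inv_act]
  have hex : ∀ z, ∃ t, act f⁻¹ [z] = [t] := fun z =>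
    List.length_eq_one_iff.1 (length_act f⁻¹ [z])
  refine ⟨f * g * f⁻¹, mul_mem (mul_mem hf hg) (inv_mem hf), fun z => ?_, ?_, fun z hz => ?_⟩
  · obtain ⟨t, ht⟩ := hex z
    rw [act_mul, act_mul, ht, hga, ← ht, act_act_inv]
  · rw [sect_mul, sect_mul, hfi, hga, sect_inv, hfi]
  · obtain ⟨t, ht⟩ := hex z
    have htx : t ≠ x := by
      rintro rfl
      have h1 := act_act_inv f [z]
      rw [ht, hfa] at h1
      exact hz (List.singleton_injective h1).symm
    rw [sect_mul, sect_mul, ht, hga, hgs t htx, mul_one, sect_inv, ht, mul_inv_cancel]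

theorem mem_isolated_of_mem (hodd : Odd d) {x y : Fin d} {h : Aut (Fin d)}
    (hh : h ∈ isolated x) : h ∈ isolated y := by
  simpa using conj_mem_isolated hodd (y := y) (one_mem (G d)) hh

/-- The defect of the braid relation between neighbouring generators is isolated. -/
theorem gen_mul_inv_mem_isolated (hd : 3 ≤ d) (i : Fin d) :
    gen i * (gen (i + 1 + 1))⁻¹ ∈ isolated (i + 1) := by
  have h1 := succ_ne_self_fin hd i
  have h2 := succ_ne_self_fin hd (i + 1)
  have h3 := add_two_ne_self_fin hd i
  set f := gen i * gen (i + 1) * gen i with hf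
  set g := gen (i + 1) * gen i * gen (i + 1) with hg
  -- On the first level both products are the transposition `(i i+2)`. Their sections differ at most
  -- at the fixed vertex `i + 1`, so `f * g⁻¹` has its only possibly nontrivial section there.
  have hact : ∀ x, act f [x] = act g [x] := by
    intro x
    simp only [hf, hg, act_mul, act_gen]
    by_cases e1 : x = i
    · subst e1
      simp [Equiv.swap_apply_def, h1.symm, h2, h3, h3.symm]
    by_cases e2 : x = i + 1
    · subst e2
      simp [Equiv.swap_apply_def, h1.symm, h2, h3, h3.symm]
    by_cases e3 : x = i + 1 + 1
    · subst e3
      simp [Equiv.swap_apply_def, h1.symm, h2, h3, h3.symm]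
    · simp [Equiv.swap_apply_of_ne_of_ne, *]
  have hfs : sect f [i + 1] = gen i * gen (i + 1) := by
    simp [hf, sect_mul, act_gen, sect_gen_self, sect_gen_succ,
      sect_gen_of_ne h1.symm h3.symm, Equiv.swap_apply_of_ne_of_ne h1.symm h3.symm]
  have hgs : sect g [i + 1] = gen (i + 1 + 1) * gen (i + 1) := by
    simp [hg, sect_mul, act_gen, sect_gen_self, sect_gen_succ,
      sect_gen_of_ne h3 h2, Equiv.swap_apply_of_ne_of_ne h3 h2]
  have hsect : ∀ x, x ≠ i + 1 → sect f [x] = sect g [x] := by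
    intro x e2
    simp only [hf, hg, act_gen, sect_mul]
    by_cases e1 : x = i
    · subst e1
      simp [Equiv.swap_apply_of_ne_of_ne h1.symm h3.symm, sect_gen_self,
        sect_gen_of_ne h1.symm h3.symm, sect_gen_of_ne h3 h2]
    by_cases e3 : x = i + 1 + 1
    · subst e3
      simp [sect_gen_succ, sect_gen_of_ne h1.symm h3.symm, Equiv.swap_apply_of_ne_of_ne h3 h2, sect_gen_of_ne h3 h2]
    · simp [Equiv.swap_apply_of_ne_of_ne, sect_gen_of_ne, *]
  have hex : ∀ z, ∃ t, act g⁻¹ [z] = [t] := fun z =>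
    List.length_eq_one_iff.1 (length_act g⁻¹ [z])
  have hgf : act g [i + 1] = [i + 1] := by
    simp [hg, act_mul, act_gen, Equiv.swap_apply_of_ne_of_ne h3 h2]
  have hgi : act g⁻¹ [i + 1] = [i + 1] := by
    conv_lhs => rw [← hgf]
    exact act_inv_act _ _
  refine ⟨f * g⁻¹, ?_, fun z => ?_, ?_, fun z hz => ?_⟩
  · have := gen_mem (d := d)
    exact mul_mem (mul_mem (mul_mem (this _) (this _)) (this _))
      (inv_mem (mul_mem (mul_mem (this _) (this _)) (this _)))
  · obtain ⟨t, ht⟩ := hex z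
    rw [act_mul, ht, hact, ← ht, act_act_inv]
  · rw [sect_mul, hgi, sect_inv, hgi, hfs, hgs]
    group
  · obtain ⟨t, ht⟩ := hex z
    have htx : t ≠ i + 1 := by
      rintro rfl
      have h1 := act_act_inv g [z]
      rw [ht, hgf] at h1
      exact hz (List.singleton_injective h1).symm
    rw [sect_mul, sect_inv, ht, hsect t htx, mul_inv_cancel]

theorem gen_mul_gen_zero_inv_mem_isolated (hd : 3 ≤ d) (hodd : Odd d) (x i : Fin d) :
    gen i * (gen 0)⁻¹ ∈ isolated x := by
  refine forall_fin_of_add_two hodd (P := fun i => gen i * (gen 0)⁻¹ ∈ isolated x) (i := 0)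
    (by rw [mul_inv_cancel]; exact one_mem _) (fun j hj => ?_) i
  have h := mem_isolated_of_mem hodd (y := x) (gen_mul_inv_mem_isolated hd j)
  have e : gen (j + 1 + 1) * (gen (0 : Fin d))⁻¹ =
      (gen j * (gen (j + 1 + 1))⁻¹)⁻¹ * (gen j * (gen 0)⁻¹) := by group
  rw [e]
  exact mul_mem (inv_mem h) hj

/-- Modulo the isolated elements, which `G_d` normalizes, every generator equals `a_0`; a word
therefore reduces to a power of `a_0` given by its exponent sum. -/
theorem evalWord_mul_zpow_mem_isolated (hd : 3 ≤ d) (hodd : Odd d) (x : Fin d)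
    (w : List (Fin d × Bool)) : evalWord w * gen 0 ^ (-expWord w) ∈ isolated x := by
  induction w with
  | nil => simp [evalWord, expWord]
  | cons l w ih =>
    obtain ⟨i, b⟩ := l
    have h := gen_mul_gen_zero_inv_mem_isolated hd hodd x i
    rw [evalWord_cons, expWord_cons]
    cases b
    · have h1 := conj_mem_isolated hodd (y := x) (inv_mem (gen_mem i)) ih
      have h2 := conj_mem_isolated hodd (y := x) (inv_mem (gen_mem i)) (inv_mem h)
      convert mul_mem h1 h2 using 1
      simp only [cond_false, neg_add, neg_neg, add_comm (1 : ℤ), zpow_add, zpow_one]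
      group
    · have h1 := conj_mem_isolated hodd (y := x) (gen_mem i) ih
      convert mul_mem h1 h using 1
      simp only [cond_true, neg_add, add_comm (-1 : ℤ), zpow_add, zpow_neg_one]
      group

theorem HasExp.mul_zpow_mem_isolated (hd : 3 ≤ d) (hodd : Odd d) (x : Fin d) {g : Aut (Fin d)}
    {n : ℤ} (hg : HasExp g n) : g * gen 0 ^ (-n) ∈ isolated x := by
  obtain ⟨w, rfl, rfl⟩ := hg.exists_word
  exact evalWord_mul_zpow_mem_isolated hd hodd x w

theorem HasExp.mem_isolated_of_zero (hd : 3 ≤ d) (hodd : Odd d) (x : Fin d) {g : Aut (Fin d)}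
    (hg : HasExp g 0) : g ∈ isolated x := by
  simpa using hg.mul_zpow_mem_isolated hd hodd x

/-- Isolated sections can be cancelled. -/
theorem sect_mem_isolated {x : Fin d} {g : Aut (Fin d)} (hg : g ∈ G d)
    (ha : ∀ y, act g [y] = [y]) (hs : ∀ y, y ≠ x → sect g [y] ∈ isolated y) :
    sect g [x] ∈ isolated x := by
  classical
  -- `S` is the set of vertices already cleared, each by multiplying with an element supported
  -- there.
  have key : ∀ S : Finset (Fin d), x ∉ S → ∃ f ∈ G d, (∀ y, act f [y] = [y]) ∧
      ∀ y, sect f [y] = if y ∈ S then 1 else sect g [y] := by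
    intro S
    induction S using Finset.induction_on with
    | empty => exact fun _ => ⟨g, hg, ha, fun y => by simp⟩
    | insert z S hz ih =>
      intro hx
      rw [Finset.mem_insert, not_or] at hx
      obtain ⟨f, hf, hfa, hfs⟩ := ih hx.2
      obtain ⟨k, hk, hka, hkz, hks⟩ := inv_mem (hs z (Ne.symm hx.1))
      refine ⟨f * k, mul_mem hf hk, fun y => by rw [act_mul, hka, hfa], fun y => ?_⟩
      rw [sect_mul, hka, hfs]
      by_cases hyz : y = z
      · subst hyz
        simp [hz, hkz]
      · simp [hyz, hks y hyz]
  obtain ⟨f, hf, hfa, hfs⟩ := key (Finset.univ.erase x) (by simp)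
  exact ⟨f, hf, hfa, by simp [hfs], fun y hy => by simp [hfs, hy]⟩

theorem gen_zero_pow_four_mem_isolated (hd : 3 ≤ d) (hodd : Odd d) :
    gen (0 : Fin d) ^ (4 : ℤ) ∈ isolated (0 : Fin d) := by
  have h1 := one_ne_zero_fin hd
  have h2 : (1 + 1 : Fin d) ≠ 1 := succ_ne_self_fin hd 1
  have h3 := one_add_one_ne_zero_fin hd
  -- The word `a_0² a_1 a_0² a_1⁻³` acts trivially on the first level and has exponent sum 2. Its
  -- sections have sum 0 away from vertex 0, hence are isolated there, and the section at 0 has sum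
  -- 4.
  let w : List (Fin d × Bool) := [(0, true), (0, true), (1, true), (0, true), (0, true),
    (1, false), (1, false), (1, false)]
  have hp : ∀ y, wordPerm w y = y := by
    intro y
    simp [w, wordPerm]
  have hexp : ∀ y, y ≠ 0 → expWord (wordSect w y) = 0 := by
    intro y e0
    by_cases e1 : y = 1
    · subst e1
      simp [w, wordSect, wordPerm, letterSect, expWord, Equiv.swap_apply_def, h1, h2, h3]
    by_cases e2 : y = 1 + 1
    · subst e2
      simp [w, wordSect, wordPerm, letterSect, expWord, Equiv.swap_apply_def, h1, h2, h3]
    · simp [w, wordSect, wordPerm, letterSect, expWord, Equiv.swap_apply_def, e0, e1, e2]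
  have hexp0 : expWord (wordSect w 0) = 4 := by
    have h := sum_expWord_wordSect hd w
    rw [Finset.sum_eq_single 0 (fun y _ hy => hexp y hy) (by simp)] at h
    rw [h]
    simp [w, expWord]
  have hmem : evalWord (wordSect w 0) ∈ isolated (0 : Fin d) := by
    rw [← sect_evalWord]
    refine sect_mem_isolated (hasExp_evalWord w).mem (fun y => by rw [act_evalWord, hp])
      fun y hy => ?_
    rw [sect_evalWord]
    have h := hasExp_evalWord (wordSect w y)
    rw [hexp y hy] at h
    exact h.mem_isolated_of_zero hd hodd y
  -- The section at 0 is isolated and agrees with `a_0^4` up to an isolated factor.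
  have h := (hasExp_evalWord (wordSect w 0)).mul_zpow_mem_isolated hd hodd 0
  rw [hexp0] at h
  have := mul_mem (inv_mem h) hmem
  simpa [mul_assoc] using this

theorem HasExp.mem_isolated (hd : 3 ≤ d) (hodd : Odd d) (x : Fin d) {g : Aut (Fin d)} {n : ℤ}
    (hg : HasExp g n) (hn : 4 ∣ n) : g ∈ isolated x := by
  obtain ⟨m, rfl⟩ := hn
  have h1 := hg.mul_zpow_mem_isolated hd hodd x
  have h2 := zpow_mem (mem_isolated_of_mem hodd (y := x) (gen_zero_pow_four_mem_isolated hd hodd)) m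
  rw [← zpow_mul] at h2
  simpa using mul_mem h1 h2

end Isolated

/-! ### Rigid stabilizers and the level product -/

section Rigid

variable {d : ℕ} [NeZero d]

theorem rist_act_self {X : Type*} {G : Subgroup (Aut X)} {u : List X} {g : Aut X}
    (hg : g ∈ rist G u) {v : List X} (hv : v.length = u.length) : act g v = v :=
  (levelRist_le_levelStab G u.length
    (Subgroup.mem_iSup_of_mem (⟨u, rfl⟩ : Level X u.length) hg)).2 v hv

theorem sect_eq_one_of_mem_rist {X : Type*} {G : Subgroup (Aut X)} {u v : List X} {g : Aut X}
    (hg : g ∈ rist G u) (hv : v.length = u.length) (hne : v ≠ u) : sect g v = 1 := by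
  refine act_ext fun t => ?_
  have h := hg.2 (v ++ t) fun hp => hne
    ((List.prefix_of_prefix_length_le (List.prefix_append v t) hp hv.le).eq_of_length hv)
  rw [act_append_sect, rist_act_self hg hv] at h
  exact List.append_cancel_left h

/-- At each letter of `u` only one section is nontrivial, so the exponent sum doubles, and that
section is rigid for the rest of `u`. -/
theorem HasExp.sect_of_rist (hd : 3 ≤ d) {u : List (Fin d)} {g : Aut (Fin d)} {n : ℤ}
    (hg : HasExp g n) (hr : g ∈ rist (G d) u) : HasExp (sect g u) (2 ^ u.length * n) := by
  induction u generalizing g n with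
  | nil => simpa [sect_nil] using hg
  | cons x u ih =>
    have hfix : act g [x] = [x] := act_eq_of_act_append (v := u) (rist_act_self hr rfl)
    have hiso : ∀ y, y ≠ x → sect g [y] = 1 := by
      intro y hy
      refine act_ext fun t => ?_
      have h := hr.2 ([y] ++ t) fun hp => hy (List.cons_prefix_cons.1 hp).1.symm
      have h' := h
      rw [act_append_sect, act_eq_of_act_append h] at h'
      exact List.append_cancel_left h'
    have h1 := hg.sect_of_isolated hd hiso
    have h2 : sect g [x] ∈ rist (G d) u := by
      refine ⟨h1.mem, fun v hv => ?_⟩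
      have h := hr.2 ([x] ++ v) fun hp => hv (List.cons_prefix_cons.1 hp).2
      rw [act_append_sect, hfix] at h
      exact List.append_cancel_left h
    have h3 := ih h1 h2
    rw [← sect_append] at h3
    rw [List.length_cons, pow_succ, mul_assoc]
    exact h3

/-- Lift from the bottom: place `h` at the last letter of `u` by an element `s`, then realize `s` at
the remaining prefix. The exponent sum of `s` is half that of `h`, which is exactly the loss of one
power of 2 from one level to the one above. -/
theorem exists_rist_of_mem_H (hd : 3 ≤ d) (hodd : Odd d) (k : ℕ) (u : List (Fin d))
    (hu : u.length = k + 1) {h : Aut (Fin d)} (hh : h ∈ H d (k + 1)) :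
    ∃ g ∈ rist (G d) u, sect g u = h := by
  have single : ∀ (x : Fin d) {h : Aut (Fin d)}, h ∈ isolated x →
      ∃ g ∈ rist (G d) [x], sect g [x] = h ∧ ∀ y, y ≠ x → sect g [y] = 1 := by
    rintro x h ⟨g, hg, hga, hgx, hgs⟩
    refine ⟨g, ⟨hg, fun v hv => ?_⟩, hgx, hgs⟩
    cases v with
    | nil => exact act_nil g
    | cons y v =>
      have hyx : y ≠ x := by
        rintro rfl
        exact hv ⟨v, rfl⟩
      have h := act_append_sect g [y] v
      rw [hga, hgs y hyx, act_one] at h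
      exact h
  induction k generalizing u h with
  | zero =>
    obtain ⟨x, rfl⟩ := List.length_eq_one_iff.1 hu
    obtain ⟨n, hn, hdvd⟩ := mem_H_iff.1 hh
    obtain ⟨g, hg, hgx, -⟩ := single x (hn.mem_isolated hd hodd x (by simpa using hdvd))
    exact ⟨g, hg, hgx⟩
  | succ k ih =>
    obtain ⟨u, x, rfl⟩ : ∃ v y, u = v ++ [y] := by
      rcases List.eq_nil_or_concat u with rfl | ⟨v, y, rfl⟩
      · simp at hu
      · exact ⟨v, y, by simp⟩
    rw [List.length_append, List.length_singleton, Nat.add_right_cancel_iff] at hu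
    obtain ⟨n, hn, hdvd⟩ := mem_H_iff.1 hh
    have h4 : (4 : ℤ) ∣ n := dvd_trans ⟨2 ^ (k + 1), by ring⟩ hdvd
    obtain ⟨s, hs, hsx, hsy⟩ := single x (hn.mem_isolated hd hodd x h4)
    obtain ⟨m, hm⟩ := exists_hasExp hs.1
    have hmn : 2 * m = n := by
      have h2 := hm.sect_of_isolated hd hsy
      rw [hsx] at h2
      exact h2.unique hd hn
    have hsH : s ∈ H d (k + 1) := by
      refine mem_H_iff.2 ⟨m, hm, ?_⟩
      rw [← hmn, pow_succ'] at hdvd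
      exact (mul_dvd_mul_iff_left two_ne_zero).1 hdvd
    obtain ⟨g, hg, hgu⟩ := ih u hu hsH
    refine ⟨g, ⟨hg.1, fun v hv => ?_⟩, by rw [sect_append, hgu, hsx]⟩
    by_cases hp : u <+: v
    · obtain ⟨t, rfl⟩ := hp
      rw [act_append_sect, rist_act_self hg rfl, hgu, hs.2 t]
      rintro ⟨r, rfl⟩
      exact hv ⟨r, by simp⟩
    · exact hg.2 v hp

/-- The depth contributes `2 ^ u.length`. The extra factor 2 is the parity of elements fixing the
first level; for `u = []` the first level need not be fixed. -/
theorem sect_mem_H_of_mem_rist (hd : 3 ≤ d) {u v : List (Fin d)} (hu : u ≠ [])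
    (hv : v.length = u.length) {g : Aut (Fin d)} (hg : g ∈ rist (G d) u) :
    sect g v ∈ H d u.length := by
  by_cases hvu : v = u
  · subst hvu
    obtain ⟨n, hn⟩ := exists_hasExp hg.1
    have hfix : ∀ x, act g [x] = [x] := by
      intro x
      obtain ⟨y, t, rfl⟩ := List.exists_cons_of_ne_nil hu
      exact act_eq_of_act_append (v := t) (rist_act_self hg rfl)
    obtain ⟨m, rfl⟩ := (hn.even hd hfix).two_dvd
    exact mem_H_iff.2 ⟨_, hn.sect_of_rist hd hg, ⟨m, by ring⟩⟩
  · rw [sect_eq_one_of_mem_rist hg hv hvu]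
    exact one_mem _

theorem map_psi_levelRist (hd : 3 ≤ d) (hodd : Odd d) {k : ℕ} (hk : 1 ≤ k) :
    ((levelRist (G d) k).subgroupOf (levelStab (G d) k)).map (psi (G d) k) =
      Subgroup.pi Set.univ (fun _ : Level (Fin d) k => H d k) := by
  classical
  apply le_antisymm
  · have hle : levelRist (G d) k ≤ ((Subgroup.pi Set.univ
        (fun _ : Level (Fin d) k => H d k)).comap (psi (G d) k)).map
          (levelStab (G d) k).subtype := by
      refine iSup_le fun u g hg => ?_
      refine ⟨⟨g, levelRist_le_levelStab _ _ (Subgroup.mem_iSup_of_mem u hg)⟩, ?_, rfl⟩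
      intro v _
      have hu : u.1 ≠ [] := by
        intro h0
        have := u.2
        rw [h0, List.length_nil] at this
        omega
      have h := sect_mem_H_of_mem_rist hd hu (v.2.trans u.2.symm) hg
      rwa [u.2] at h
    rintro _ ⟨g, hg, rfl⟩
    obtain ⟨g', hg', he⟩ := hle hg
    rw [← Subtype.ext he]
    exact hg'
  · have : Finite (Level (Fin d) k) := inferInstanceAs (Finite (List.Vector (Fin d) k))
    -- As the level is finite, the product is generated by its factors, and one vertex at a time
    -- suffices.
    rw [Subgroup.pi_le_iff]
    rintro u _ ⟨h, hh, rfl⟩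
    obtain ⟨j, rfl⟩ := Nat.exists_eq_add_of_le' hk
    obtain ⟨g, hg, hgu⟩ := exists_rist_of_mem_H hd hodd j u.1 u.2 hh
    have hr : g ∈ levelRist (G d) (j + 1) := Subgroup.mem_iSup_of_mem u hg
    refine ⟨⟨g, levelRist_le_levelStab _ _ hr⟩, hr, funext fun v => ?_⟩
    change sect g v.1 = (Pi.mulSingle u h : Level (Fin d) (j + 1) → Aut (Fin d)) v
    by_cases hv : v = u
    · subst hv
      rw [Pi.mulSingle_eq_same, hgu]
    · rw [Pi.mulSingle_eq_of_ne hv]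
      exact sect_eq_one_of_mem_rist hg (v.2.trans u.2.symm) fun h => hv (Subtype.ext h)

end Rigid

end RootedTree

theorem mainTheorem2 (d : ℕ) [NeZero d] (hd : 3 ≤ d) (hodd : Odd d) :
    (∀ v w : FreeGroup (Fin d), RootedTree.eval v = RootedTree.eval w →
      RootedTree.expSum v = RootedTree.expSum w) ∧
    ∀ k : ℕ, 1 ≤ k →
      ((RootedTree.levelRist (RootedTree.G d) k).subgroupOf
          (RootedTree.levelStab (RootedTree.G d) k)).map (RootedTree.psi (RootedTree.G d) k) =
        Subgroup.pi Set.univ (fun _ : RootedTree.Level (Fin d) k => RootedTree.H d k) :=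
  ⟨fun _ _ h => RootedTree.expSum_eq_of_eval_eq hd h,
    fun _ hk => RootedTree.map_psi_levelRist hd hodd hk⟩
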